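/- Let $A$ be a finite alphabet, $p\ge 2$, and let $\tau:A\to A^{p}$ be a substitution of constant length $p$, extended by concatenation to finite words and to two-sided sequences (so that $\tau(x)$ has the word $\tau(x_m)$ on the coordinates $pm,\dots,pm+p-1$). Assume that $\tau$ is primitive: for some $n$, every $a\in A$ appears in $\tau^n(b)$ for every $b\in A$. Let $X_\tau\subseteq A^{\mathbb Z}$ be the subshift generated by $\tau$, that is, the set of all two-sided sequences whose finite subwords all occur in words $\tau^n(a)$, $n\ge 0$, $a\in A$, with the topology induced by the product topology; let $T$ be the shift $(Tx)_i=x_{i+1}$, and assume that $X_\tau$ is infinite. Let $\mathcal O_p=\varprojlim_k \mathbb Z/p^k\mathbb Z$ be the $p$-odometer, with $T_0z=z+1$. Then for every $x\in X_\tau$ there are a unique sequence $(x^{(i)})_{i\ge 0}$ in $X_\tau$ and a unique sequence $(\delta_i)_{i\ge 0}$ in $\{0,\dots,p-1\}$ such that $x^{(0)}=x$ and $\tau(x^{(i+1)})=T^{-\delta_i}(x^{(i)})$ for all $i\ge 0$. The map $\pi:X_\tau\to\mathcal O_p$, $\pi(x)=\sum_{i\ge 0}\delta_i p^i$, is a factor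 map from $(X_\tau,T)$ onto $(\mathcal O_p,T_0)$, that is, it is continuous and surjective, and $\pi\circ T=T_0\circ\pi$. For every $z\in\mathcal O_p$ the fibre $\pi^{-1}(\{z\})$ is finite and has fewer than $K$ points, where $K$ is the number of words of length $3$ that occur in points of $X_\tau$. Consequently, all scrambled sets of $(X_\tau,T)$ are finite: if $\varrho$ is a metric that induces the topology of $X_\tau$, and $S\subseteq X_\tau$ is such that $$\limsup_{n\to\infty}\varrho(T^nx,T^ny)>0\quad\text{and}\quad \liminf_{n\to\infty}\varrho(T^nx,T^ny)=0$$ for any two distinct points $x,y\in S$, then $S$ is finite. -/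

import Mathlib

open Filter Topology

namespace ConstLength

/-! Throughout, `A` is the alphabet and a substitution of constant length `p` is a map
`τ : A → Fin p → A`, the word `τ a` being `τ a 0, …, τ a (p - 1)`. -/

section Substitution

variable {A : Type*} {p : ℕ}

/-- The extension of `τ` to finite words, by concatenation. -/
def onWord (τ : A → Fin p → A) (w : List A) : List A :=
  w.flatMap fun a => List.ofFn (τ a)

/-- The word `τ ^ n (a)`. -/
def iterWord (τ : A → Fin p → A) (n : ℕ) (a : A) : List A :=
  (onWord τ)^[n] [a]

/-- `τ` is primitive: for some `n`, every letter appears in `τ ^ n (b)` for every letter `b`. -/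
def IsPrimitive (τ : A → Fin p → A) : Prop :=
  ∃ n : ℕ, ∀ a b : A, a ∈ iterWord τ n b

/-- The extension of `τ` to two-sided sequences: coordinates `p * m, …, p * m + p - 1` of the
image form the word `τ (x m)`. -/
def onSeq [NeZero p] (τ : A → Fin p → A) (x : ℤ → A) : ℤ → A :=
  fun i => τ (x (i / (p : ℤ))) (Fin.ofNat p (i % (p : ℤ)).toNat)

/-- The power `T ^ k` of the shift map, `k ∈ ℤ`; the shift map `T` itself is the case `k = 1`. -/
def shiftBy (k : ℤ) (x : ℤ → A) : ℤ → A :=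
  fun i => x (i + k)

/-- The word of length `n` of `x` that starts at coordinate `i`. -/
def subword (x : ℤ → A) (i : ℤ) (n : ℕ) : List A :=
  List.ofFn fun j : Fin n => x (i + (j : ℕ))

/-- The subshift `X_τ`: all two-sided sequences each of whose finite words occurs in some word
`τ ^ n (a)`. Any closed set `Y` with `T Y = Y` in which all words `τ ^ n (a)` appear contains it, and
for primitive `τ` of length at least two it is the smallest such set. -/
def subshift (τ : A → Fin p → A) : Set (ℤ → A) :=
  {x | ∀ (i : ℤ) (l : ℕ), ∃ (n : ℕ) (a : A), subword x i l <:+: iterWord τ n a}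

theorem shiftBy_mem (τ : A → Fin p → A) (k : ℤ) {x : ℤ → A} (hx : x ∈ subshift τ) :
    shiftBy k x ∈ subshift τ := by
  intro i l
  obtain ⟨n, a, h⟩ := hx (i + k) l
  refine ⟨n, a, ?_⟩
  have e : subword (shiftBy k x) i l = subword x (i + k) l := by
    unfold subword shiftBy
    congr 1
    funext j
    congr 1
    ring
  rw [e]
  exact h

/-- The shift map `T` on `X_τ`. -/
def shift (τ : A → Fin p → A) (x : subshift τ) : subshift τ :=
  ⟨shiftBy 1 x.1, shiftBy_mem τ 1 x.2⟩

/-- The set of words of length `l` of `X_τ`. -/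
def wordsOfLength (τ : A → Fin p → A) (l : ℕ) : Set (List A) :=
  {w | ∃ x ∈ subshift τ, ∃ i : ℤ, w = subword x i l}

end Substitution

section Odometer

/-- The `p`-odometer as a topological ring: the inverse limit of the (discrete) rings
`ℤ / p ^ k ℤ`, `k ∈ ℕ`, under the reduction maps. Its topology is the one induced by the product
of the discrete topologies of the `ZMod (p ^ k)`. -/
def odometer (p : ℕ) : Subring (∀ k : ℕ, ZMod (p ^ k)) where
  carrier := {f | ∀ k : ℕ,
    ZMod.castHom (pow_dvd_pow p k.le_succ) (ZMod (p ^ k)) (f (k + 1)) = f k}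
  mul_mem' := fun {a b} ha hb k => by rw [Pi.mul_apply, map_mul, ha k, hb k, Pi.mul_apply]
  one_mem' := fun k => by rw [Pi.one_apply, map_one, Pi.one_apply]
  add_mem' := fun {a b} ha hb k => by rw [Pi.add_apply, map_add, ha k, hb k, Pi.add_apply]
  zero_mem' := fun k => by rw [Pi.zero_apply, map_zero, Pi.zero_apply]
  neg_mem' := fun {a} ha k => by rw [Pi.neg_apply, map_neg, ha k, Pi.neg_apply]

/-- The translation `T₀ z = z + 1` of the odometer. -/
def addOne (p : ℕ) (z : odometer p) : odometer p :=
  z + 1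

/-- The point `∑ i, δ i * p ^ i` of the odometer whose base `p` expansion is `δ`. -/
def ofDigits {p : ℕ} (δ : ℕ → Fin p) : odometer p :=
  ⟨fun k => ∑ i ∈ Finset.range k, ((δ i : ℕ) : ZMod (p ^ k)) * (p : ZMod (p ^ k)) ^ i, by
    intro k
    have h : (p : ZMod (p ^ k)) ^ k = 0 := by
      rw [← Nat.cast_pow]
      exact ZMod.natCast_self _
    simp only [map_sum, map_mul, map_pow, map_natCast]
    rw [Finset.sum_range_succ, h, mul_zero, add_zero]⟩

end Odometer

section FactorMap

variable {A : Type*} {p : ℕ} [NeZero p]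

/-- The points `y 0, y 1, …` of `X_τ` and the digits `δ` desubstitute `x`: `y 0 = x` and
`τ (y (i + 1)) = T ^ (- δ i) (y i)` for all `i`. -/
def Desubstitutes (τ : A → Fin p → A) (x : subshift τ) (y : ℕ → subshift τ)
    (δ : ℕ → Fin p) : Prop :=
  y 0 = x ∧ ∀ i : ℕ, onSeq τ (y (i + 1)).1 = shiftBy (-((δ i : ℕ) : ℤ)) (y i).1

open Classical in
/-- The map `π : X_τ → O_p` sending `x` to the point with expansion `δ`, where `δ` is the digit
sequence that desubstitutes `x`. (Existence and uniqueness of `δ` are theorems for primitive `τ`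
with infinite `X_τ`; the value `0` is a default that is then never used.) -/
noncomputable def toOdometer (τ : A → Fin p → A) (x : subshift τ) : odometer p :=
  if h : ∃ q : (ℕ → subshift τ) × (ℕ → Fin p), Desubstitutes τ x q.1 q.2 then
    ofDigits h.choose.2
  else 0

end FactorMap

section Dynamics

/-- `f` is a factor map from the system `(X, T)` onto the system `(Y, S)`. -/
def IsFactorMap {X Y : Type*} [TopologicalSpace X] [TopologicalSpace Y]
    (T : X → X) (S : Y → Y) (f : X → Y) : Prop :=
  Continuous f ∧ Function.Surjective f ∧ ∀ x, f (T x) = S (f x)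

/-- Li–Yorke pairs of a self-map of a compact metric space. -/
def IsLiYorkePair {X : Type*} [MetricSpace X] (T : X → X) (x y : X) : Prop :=
  0 < limsup (fun n : ℕ => dist (T^[n] x) (T^[n] y)) atTop ∧
    liminf (fun n : ℕ => dist (T^[n] x) (T^[n] y)) atTop = 0

/-- Scrambled sets: any two distinct points form a Li–Yorke pair. -/
def IsScrambled {X : Type*} [MetricSpace X] (T : X → X) (S : Set X) : Prop :=
  ∀ x ∈ S, ∀ y ∈ S, x ≠ y → IsLiYorkePair T x y

end Dynamics

end ConstLength

/-! The levels `T ^ i (τ ^ k (X_τ))` of the `k`-th tower cover `X_τ`, and by minimality any two of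
them are equal or disjoint; let `c k` be the number of distinct ones, a divisor of `p ^ k`. A word
of length `p ^ k + 1 - c k` begins at one of the first `c k` coordinates of some `τ ^ k (a)`, so
there are at most `|A| * c k` such words, while an infinite subshift has more than `n` words of
every length `n`. Hence `p ^ k / c k` is bounded, and comparison with an index at which it is
maximal shows that `p ^ k` divides `c (k + m)` for a fixed `m`: a point lies in levels `i` and `j`
of the `k`-th tower only if `i ≡ j` modulo `p ^ k`. This is recognizability, and `π` records the
levels of a point.

Around the origin, a point of the fibre over `z` is on arbitrarily large windows a shift of some
`τ ^ k (y)` in which only two letters of `y`, at fixed positions, are visible. So the fibre has at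
most as many points as there are words of length two, and fewer words have length two than three.
Finally, the coordinates of `π` are locally constant and are moved by a bijection at each step, so
they agree on Li–Yorke pairs: a scrambled set lies in a single fibre. -/

namespace ConstLength

section Words

variable {A : Type*} {p : ℕ}

theorem take_drop_isInfix (w : List A) {i j l m : ℕ} (hij : j ≤ i) (hlm : i + l ≤ j + m) :
    (w.drop i).take l <:+: (w.drop j).take m := by
  obtain ⟨s, rfl⟩ := Nat.exists_eq_add_of_le hij
  have h : (w.drop (j + s)).take l = (((w.drop j).take m).drop s).take l := by
    rw [List.drop_take, List.take_take, List.drop_drop, min_eq_left (by omega)]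
  exact h ▸ (List.take_prefix _ _).isInfix.trans (List.drop_suffix _ _).isInfix

theorem exists_eq_take_drop_of_isInfix {u w : List A} (h : u <:+: w) :
    ∃ i, i + u.length ≤ w.length ∧ u = (w.drop i).take u.length := by
  obtain ⟨s, t, rfl⟩ := h
  exact ⟨s.length, by simp, by simp⟩

theorem iterate_onWord_append (τ : A → Fin p → A) (n : ℕ) (u v : List A) :
    (onWord τ)^[n] (u ++ v) = (onWord τ)^[n] u ++ (onWord τ)^[n] v := by
  induction n generalizing u v with
  | zero => rfl
  | succ n ih => simp only [Function.iterate_succ_apply, onWord, List.flatMap_append, ← ih]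

theorem length_onWord (τ : A → Fin p → A) (w : List A) : (onWord τ w).length = p * w.length := by
  simp [onWord, List.length_flatMap, mul_comm]

theorem length_iterate_onWord (τ : A → Fin p → A) (n : ℕ) (w : List A) :
    ((onWord τ)^[n] w).length = p ^ n * w.length := by
  induction n with
  | zero => simp
  | succ n ih => rw [Function.iterate_succ_apply', length_onWord, ih, pow_succ', mul_assoc]

theorem length_iterWord (τ : A → Fin p → A) (n : ℕ) (a : A) : (iterWord τ n a).length = p ^ n := by
  simp [iterWord, length_iterate_onWord]

theorem iterWord_add (τ : A → Fin p → A) (m n : ℕ) (a : A) :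
    iterWord τ (m + n) a = (onWord τ)^[m] (iterWord τ n a) :=
  Function.iterate_add_apply _ m n [a]

theorem iterate_onWord_isInfix (τ : A → Fin p → A) (n : ℕ) {u v : List A} (h : u <:+: v) :
    (onWord τ)^[n] u <:+: (onWord τ)^[n] v := by
  obtain ⟨s, t, rfl⟩ := h
  exact ⟨(onWord τ)^[n] s, (onWord τ)^[n] t, by simp only [iterate_onWord_append]⟩

theorem iterWord_getElem (τ : A → Fin p → A) (n : ℕ) (w : List A) (q : ℕ) (hq : q < w.length) :
    iterWord τ n w[q] = (((onWord τ)^[n] w).drop (p ^ n * q)).take (p ^ n) := by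
  have hsplit : w = w.take q ++ ([w[q]] ++ w.drop (q + 1)) := by simp
  have hlen : ((onWord τ)^[n] (w.take q)).length = p ^ n * q := by
    rw [length_iterate_onWord, List.length_take_of_le hq.le]
  conv_rhs => rw [hsplit, iterate_onWord_append, iterate_onWord_append, ← iterWord]
  rw [← hlen, List.drop_left, ← length_iterWord τ n w[q], List.take_left]

theorem exists_iterWord_isInfix [NeZero p] (τ : A → Fin p → A) (n : ℕ) {u w : List A}
    (h : u <:+: (onWord τ)^[n] w) (hu : 2 * p ^ n ≤ u.length) : ∃ b, iterWord τ n b <:+: u := by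
  obtain ⟨i, hi, hui⟩ := exists_eq_take_drop_of_isInfix h
  rw [length_iterate_onWord] at hi
  have hpos : 0 < p ^ n := NeZero.pos _
  -- the first block of length `p ^ n` that starts in `u` is contained in `u`
  obtain ⟨q, hiq, hqi⟩ : ∃ q, i ≤ p ^ n * q ∧ p ^ n * q ≤ i + p ^ n :=
    ⟨i / p ^ n + 1, (Nat.lt_mul_div_succ i hpos).le, by
      rw [mul_add_one]; exact Nat.add_le_add_right (Nat.mul_div_le i _) _⟩
  have hq : q < w.length := by
    by_contra! hle
    have := Nat.mul_le_mul_left (p ^ n) hle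
    omega
  refine ⟨w[q], ?_⟩
  rw [hui, iterWord_getElem]
  exact take_drop_isInfix _ hiq (by omega)

end Words

section Sequences

variable {A : Type*} {p : ℕ}

theorem shiftBy_shiftBy (k l : ℤ) (x : ℤ → A) : shiftBy k (shiftBy l x) = shiftBy (k + l) x :=
  funext fun i => congrArg x (by ring)

theorem shiftBy_zero (x : ℤ → A) : shiftBy 0 x = x :=
  funext fun i => congrArg x (add_zero i)

theorem shiftBy_injective (k : ℤ) : Function.Injective (shiftBy k : (ℤ → A) → ℤ → A) :=
  Function.LeftInverse.injective (g := shiftBy (-k)) fun x => by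
    rw [shiftBy_shiftBy, neg_add_cancel, shiftBy_zero]

theorem length_subword (x : ℤ → A) (i : ℤ) (l : ℕ) : (subword x i l).length = l := by
  simp [subword]

theorem subword_shiftBy (x : ℤ → A) (k i : ℤ) (l : ℕ) :
    subword (shiftBy k x) i l = subword x (i + k) l := by
  simp only [subword, shiftBy, add_right_comm]

theorem subword_eq_iff_eqOn {x y : ℤ → A} {i : ℤ} {l : ℕ} :
    subword x i l = subword y i l ↔ Set.EqOn x y (Set.Ico i (i + l)) := by
  rw [subword, subword, List.ofFn_injective.eq_iff, funext_iff]
  refine ⟨fun h j hj => ?_, fun h t => h ⟨by omega, by omega⟩⟩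
  obtain ⟨t, rfl⟩ := Int.le.dest hj.1
  exact h ⟨t, by simpa using hj.2⟩

theorem subword_eq_take_drop (x : ℤ → A) (i : ℤ) {s l m : ℕ} (h : s + l ≤ m) :
    subword x (i + s) l = ((subword x i m).drop s).take l := by
  refine List.ext_getElem ?_ fun t _ _ => ?_
  · simp only [List.length_take, List.length_drop, length_subword]
    omega
  · simp [subword, add_assoc]

theorem take_subword (x : ℤ → A) (i : ℤ) {l m : ℕ} (h : l ≤ m) :
    (subword x i m).take l = subword x i l := by
  simpa using (subword_eq_take_drop x i (s := 0) (by omega : 0 + l ≤ m)).symm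

theorem subword_isInfix (x : ℤ → A) {i j : ℤ} {l m : ℕ} (hij : j ≤ i) (hlm : i + l ≤ j + m) :
    subword x i l <:+: subword x j m := by
  obtain ⟨s, rfl⟩ := Int.le.dest hij
  rw [subword_eq_take_drop x j (by omega : s + l ≤ m)]
  exact (List.take_prefix _ _).isInfix.trans (List.drop_suffix _ _).isInfix

theorem exists_eq_subword_of_isInfix {x : ℤ → A} {i : ℤ} {l : ℕ} {u : List A}
    (h : u <:+: subword x i l) : ∃ j, u = subword x j u.length := by
  obtain ⟨s, hs, hu⟩ := exists_eq_take_drop_of_isInfix h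
  rw [length_subword] at hs
  exact ⟨i + s, by rwa [subword_eq_take_drop x i hs]⟩

variable [NeZero p]

theorem onSeq_mul_add (τ : A → Fin p → A) (x : ℤ → A) (i : ℤ) (j : Fin p) :
    onSeq τ x (p * i + (j : ℕ)) = τ (x i) j := by
  have hj : ((j : ℕ) : ℤ) < p := by exact_mod_cast j.2
  have hdiv : (p * i + (j : ℕ)) / (p : ℤ) = i := by
    rw [Int.mul_add_ediv_left _ _ (by simp [NeZero.ne p]),
      Int.ediv_eq_zero_of_lt (by positivity) hj, add_zero]
  have hmod : (p * i + (j : ℕ)) % (p : ℤ) = (j : ℕ) := by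
    rw [Int.mul_add_emod_self_left, Int.emod_eq_of_lt (by positivity) hj]
  simp [onSeq, hdiv, hmod]

theorem subword_onSeq (τ : A → Fin p → A) (x : ℤ → A) (i : ℤ) (l : ℕ) :
    subword (onSeq τ x) (p * i) (p * l) = onWord τ (subword x i l) := by
  rw [subword, List.ofFn_mul', onWord, subword, List.flatMap_def, List.map_ofFn]
  congr 2
  funext t
  refine congrArg List.ofFn (funext fun j => ?_)
  rw [← onSeq_mul_add τ x]
  congr 1
  push_cast
  ring

theorem subword_iterate_onSeq (τ : A → Fin p → A) (n : ℕ) (x : ℤ → A) (i : ℤ) (l : ℕ) :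
    subword ((onSeq τ)^[n] x) (p ^ n * i) (p ^ n * l) = (onWord τ)^[n] (subword x i l) := by
  induction n with
  | zero => simp
  | succ n ih =>
    rw [Function.iterate_succ_apply', Function.iterate_succ_apply', ← ih, ← subword_onSeq]
    congr 1 <;> ring

theorem subword_iterate_onSeq_block (τ : A → Fin p → A) (n : ℕ) (x : ℤ → A) (i : ℤ) :
    subword ((onSeq τ)^[n] x) (p ^ n * i) (p ^ n) = iterWord τ n (x i) := by
  simpa [subword, iterWord] using subword_iterate_onSeq τ n x i 1

theorem iterate_onSeq_apply_congr {τ : A → Fin p → A} {n : ℕ} {x y : ℤ → A} {m : ℤ}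
    (h : iterWord τ n (x (m / p ^ n)) = iterWord τ n (y (m / p ^ n))) :
    (onSeq τ)^[n] x m = (onSeq τ)^[n] y m := by
  have hpos : (0 : ℤ) < p ^ n := by exact_mod_cast NeZero.pos (p ^ n)
  rw [← subword_iterate_onSeq_block, ← subword_iterate_onSeq_block, subword_eq_iff_eqOn] at h
  refine h ⟨Int.mul_ediv_self_le hpos.ne', ?_⟩
  exact_mod_cast Int.lt_mul_ediv_self_add hpos

theorem iterate_onSeq_eq_iff {τ : A → Fin p → A} {n : ℕ} {x y : ℤ → A} :
    (onSeq τ)^[n] x = (onSeq τ)^[n] y ↔ ∀ i, iterWord τ n (x i) = iterWord τ n (y i) := by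
  refine ⟨fun h i => ?_, fun h => funext fun m => iterate_onSeq_apply_congr (h _)⟩
  rw [← subword_iterate_onSeq_block, h, subword_iterate_onSeq_block]

theorem onSeq_shiftBy (τ : A → Fin p → A) (k : ℤ) (x : ℤ → A) :
    onSeq τ (shiftBy k x) = shiftBy (p * k) (onSeq τ x) := by
  have hp : (p : ℤ) ≠ 0 := Nat.cast_ne_zero.2 (NeZero.ne p)
  funext i
  simp only [onSeq, shiftBy, Int.add_mul_ediv_left _ _ hp, Int.add_mul_emod_self_left]

theorem iterate_onSeq_shiftBy (τ : A → Fin p → A) (n : ℕ) (k : ℤ) (x : ℤ → A) :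
    (onSeq τ)^[n] (shiftBy k x) = shiftBy (p ^ n * k) ((onSeq τ)^[n] x) := by
  induction n with
  | zero => simp
  | succ n ih =>
    rw [Function.iterate_succ_apply', Function.iterate_succ_apply', ih, onSeq_shiftBy, pow_succ',
      mul_assoc]

theorem iterate_onSeq_mem (τ : A → Fin p → A) (n : ℕ) {x : ℤ → A} (hx : x ∈ subshift τ) :
    (onSeq τ)^[n] x ∈ subshift τ := by
  intro i l
  have hpos : (0 : ℤ) < p ^ n := by exact_mod_cast NeZero.pos (p ^ n)
  obtain ⟨m, a, h⟩ := hx (i / p ^ n) (l + 1)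
  refine ⟨n + m, a, ?_⟩
  rw [iterWord_add]
  refine .trans ?_ (iterate_onWord_isInfix τ n h)
  rw [← subword_iterate_onSeq]
  refine subword_isInfix _ (Int.mul_ediv_self_le hpos.ne') ?_
  have hstart := Int.lt_mul_ediv_self_add (x := i) hpos
  have hlen : (l : ℤ) ≤ p ^ n * l := le_mul_of_one_le_left (by positivity) (by omega)
  push_cast
  linarith

end Sequences

section Minimality

variable {A : Type*} {p : ℕ} {τ : A → Fin p → A}

theorem exists_eqOn_shiftBy (hp : 2 ≤ p) (hprim : IsPrimitive τ) {x f : ℤ → A}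
    (hx : x ∈ subshift τ) (hf : f ∈ subshift τ) (i : ℤ) (l : ℕ) :
    ∃ k, Set.EqOn (shiftBy k f) x (Set.Ico i (i + l)) := by
  have : NeZero p := ⟨by omega⟩
  obtain ⟨N, hN⟩ := hprim
  obtain ⟨n, a, hxa⟩ := hx i l
  obtain ⟨m, c, hm⟩ := hf 0 (2 * p ^ (n + N))
  have hpos : 0 < p ^ (n + N) := NeZero.pos _
  obtain ⟨k, rfl⟩ : ∃ k, m = n + N + k := by
    have hlen := hm.length_le
    rw [length_subword, length_iterWord] at hlen
    exact Nat.exists_eq_add_of_le ((Nat.pow_lt_pow_iff_right (by omega : 1 < p)).1 (by omega)).le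
  rw [iterWord_add] at hm
  -- a long word of `f` contains a word `τ ^ (n + N) (b)`, which contains `τ ^ n (a)`
  obtain ⟨b, hb⟩ := exists_iterWord_isInfix τ (n + N) hm (length_subword f _ _).ge
  rw [iterWord_add] at hb
  have hab : [a] <:+: iterWord τ N b := (List.singleton_infix_iff _ _).2 (hN a b)
  obtain ⟨j, hj⟩ :=
    exists_eq_subword_of_isInfix (hxa.trans ((iterate_onWord_isInfix τ n hab).trans hb))
  refine ⟨j - i, subword_eq_iff_eqOn.1 ?_⟩
  rw [subword_shiftBy, add_sub_cancel, hj, length_subword]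

variable [TopologicalSpace A]

theorem continuous_shiftBy (k : ℤ) : Continuous (shiftBy k : (ℤ → A) → ℤ → A) :=
  continuous_pi fun i => continuous_apply (i + k)

theorem subshift_subset_of_isClosed (hp : 2 ≤ p) (hprim : IsPrimitive τ) {F : Set (ℤ → A)}
    (hF : IsClosed F) (hinv : ∀ k : ℤ, ∀ x ∈ F, shiftBy k x ∈ F)
    (hne : (F ∩ subshift τ).Nonempty) : subshift τ ⊆ F := by
  intro x hx
  obtain ⟨f, hfF, hf⟩ := hne
  choose k hk using fun L : ℕ => exists_eqOn_shiftBy hp hprim hx hf (-L) (2 * L + 1)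
  have hlim : Tendsto (fun L : ℕ => shiftBy (k L) f) atTop (𝓝 x) := by
    refine tendsto_pi_nhds.2 fun i => tendsto_const_nhds.congr' ?_
    filter_upwards [eventually_ge_atTop i.natAbs] with L hL
    exact (hk L ⟨by omega, by push_cast; omega⟩).symm
  exact hF.mem_of_tendsto hlim (Eventually.of_forall fun L => hinv _ _ hfF)

variable [DiscreteTopology A]

theorem continuous_onSeq [NeZero p] (τ : A → Fin p → A) : Continuous (onSeq τ) :=
  continuous_pi fun i =>
    (continuous_of_discreteTopology (f := fun a => τ a (Fin.ofNat p (i % (p : ℤ)).toNat))).comp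
      (continuous_apply (i / (p : ℤ)))

theorem isClosed_subshift (τ : A → Fin p → A) : IsClosed (subshift τ) := by
  simp only [subshift, Set.ofPred_forall]
  refine isClosed_iInter fun i => isClosed_iInter fun l => ?_
  have hc : Continuous fun (x : ℤ → A) (j : Fin l) => x (i + (j : ℕ)) :=
    continuous_pi fun j => continuous_apply _
  exact (isClosed_discrete
    {g : Fin l → A | ∃ (n : ℕ) (a : A), List.ofFn g <:+: iterWord τ n a}).preimage hc

end Minimality

section Towers

variable {A : Type*} {p : ℕ} [NeZero p]

/-- The level `T ^ i (τ ^ k (X_τ))` of the `k`-th Kakutani–Rokhlin tower of `X_τ`. Since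
`T ^ (p ^ k)` preserves `τ ^ k (X_τ)`, only `i` modulo `p ^ k` matters. -/
def towerLevel (τ : A → Fin p → A) (k : ℕ) (i : ℤ) : Set (ℤ → A) :=
  (fun y => shiftBy i ((onSeq τ)^[k] y)) '' subshift τ

theorem towerLevel_subset (τ : A → Fin p → A) (k : ℕ) (i : ℤ) : towerLevel τ k i ⊆ subshift τ :=
  Set.image_subset_iff.2 fun _ hy => shiftBy_mem τ i (iterate_onSeq_mem τ k hy)

theorem image_shiftBy_towerLevel (τ : A → Fin p → A) (k : ℕ) (i j : ℤ) :
    shiftBy j '' towerLevel τ k i = towerLevel τ k (i + j) := by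
  simp only [towerLevel, Set.image_image, shiftBy_shiftBy, add_comm j]

theorem shiftBy_mem_towerLevel {τ : A → Fin p → A} {k : ℕ} {i : ℤ} {x : ℤ → A}
    (h : x ∈ towerLevel τ k i) (j : ℤ) : shiftBy j x ∈ towerLevel τ k (i + j) :=
  image_shiftBy_towerLevel τ k i j ▸ Set.mem_image_of_mem _ h

theorem image_iterate_onSeq_towerLevel (τ : A → Fin p → A) (j k : ℕ) (i : ℤ) :
    (onSeq τ)^[j] '' towerLevel τ k i = towerLevel τ (j + k) (p ^ j * i) := by
  simp only [towerLevel, Set.image_image, iterate_onSeq_shiftBy, Function.iterate_add_apply]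

theorem towerLevel_subset_add (τ : A → Fin p → A) (k j : ℕ) (i : ℤ) :
    towerLevel τ (k + j) i ⊆ towerLevel τ k i := by
  rintro _ ⟨y, hy, rfl⟩
  exact ⟨(onSeq τ)^[j] y, iterate_onSeq_mem τ j hy, by simp only [Function.iterate_add_apply]⟩

theorem towerLevel_congr (τ : A → Fin p → A) {k : ℕ} {i j : ℤ} (h : i ≡ j [ZMOD p ^ k]) :
    towerLevel τ k i = towerLevel τ k j := by
  have subset {i j : ℤ} (h : i ≡ j [ZMOD p ^ k]) : towerLevel τ k j ⊆ towerLevel τ k i := by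
    obtain ⟨m, hm⟩ := h.dvd
    rintro _ ⟨y, hy, rfl⟩
    refine ⟨shiftBy m y, shiftBy_mem τ m hy, ?_⟩
    simp only [iterate_onSeq_shiftBy, shiftBy_shiftBy, ← hm, add_sub_cancel]
  exact (subset h.symm).antisymm (subset h)

variable [TopologicalSpace A] [DiscreteTopology A]

theorem continuous_shiftBy_iterate_onSeq (τ : A → Fin p → A) (k : ℕ) (i : ℤ) :
    Continuous fun y => shiftBy i ((onSeq τ)^[k] y) :=
  (continuous_shiftBy i).comp ((continuous_onSeq τ).iterate k)

theorem isCompact_towerLevel [Finite A] (τ : A → Fin p → A) (k : ℕ) (i : ℤ) :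
    IsCompact (towerLevel τ k i) :=
  (isClosed_subshift τ).isCompact.image (continuous_shiftBy_iterate_onSeq τ k i)

end Towers

section Partition

variable {A : Type*} [Finite A] {p : ℕ} [NeZero p] {τ : A → Fin p → A}

/-- `T ^ (p ^ k)` acts minimally on each level of the `k`-th tower. -/
theorem towerLevel_eq_of_mem (hp : 2 ≤ p) (hprim : IsPrimitive τ) {k : ℕ} {i j : ℤ} {x : ℤ → A}
    (hi : x ∈ towerLevel τ k i) (hj : x ∈ towerLevel τ k j) :
    towerLevel τ k i = towerLevel τ k j := by
  let _ : TopologicalSpace A := ⊥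
  have _ : DiscreteTopology A := ⟨rfl⟩
  have subset (i j : ℤ) (hi : x ∈ towerLevel τ k i) (hj : x ∈ towerLevel τ k j) :
      towerLevel τ k i ⊆ towerLevel τ k j := by
    have hclosed := (isCompact_towerLevel τ k j).isClosed.preimage
      (continuous_shiftBy_iterate_onSeq τ k i)
    refine Set.image_subset_iff.2 (subshift_subset_of_isClosed hp hprim hclosed ?_ ?_)
    · intro m y hy
      have h := shiftBy_mem_towerLevel hy (p ^ k * m)
      rw [shiftBy_shiftBy, towerLevel_congr (j := j) τ (by simp [Int.ModEq])] at h
      rwa [Set.mem_preimage, iterate_onSeq_shiftBy, shiftBy_shiftBy, add_comm]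
    · obtain ⟨y, hy, rfl⟩ := hi
      exact ⟨y, hj, hy⟩
  exact (subset i j hi hj).antisymm (subset j i hj hi)

theorem exists_mem_towerLevel (hp : 2 ≤ p) (hprim : IsPrimitive τ) {x : ℤ → A}
    (hx : x ∈ subshift τ) (k : ℕ) : ∃ i, x ∈ towerLevel τ k i := by
  let _ : TopologicalSpace A := ⊥
  have _ : DiscreteTopology A := ⟨rfl⟩
  have hunion : ⋃ i, towerLevel τ k i = ⋃ i ∈ Set.Ico 0 ((p : ℤ) ^ k), towerLevel τ k i := by
    refine (Set.iUnion_subset fun i => ?_).antisymm (Set.iUnion₂_subset_iUnion _ _)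
    rw [← towerLevel_congr τ (Int.mod_modEq i (p ^ k))]
    have hpos : (0 : ℤ) < p ^ k := by exact_mod_cast NeZero.pos (p ^ k)
    exact Set.subset_biUnion_of_mem
      (show i % p ^ k ∈ Set.Ico 0 ((p : ℤ) ^ k) from
        ⟨Int.emod_nonneg i hpos.ne', Int.emod_lt_of_pos i hpos⟩)
  have hclosed : IsClosed (⋃ i, towerLevel τ k i) :=
    hunion ▸ (Set.finite_Ico _ _).isClosed_biUnion fun i _ => (isCompact_towerLevel τ k i).isClosed
  refine Set.mem_iUnion.1 (subshift_subset_of_isClosed hp hprim hclosed (fun m y hy => ?_) ?_ hx)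
  · obtain ⟨i, hi⟩ := Set.mem_iUnion.1 hy
    exact Set.mem_iUnion.2 ⟨i + m, shiftBy_mem_towerLevel hi m⟩
  · exact ⟨(onSeq τ)^[k] x, Set.mem_iUnion.2 ⟨0, x, hx, by simp only [shiftBy_zero]⟩,
      iterate_onSeq_mem τ k hx⟩

end Partition

section Complexity

variable {A : Type*}

theorem encard_le_of_separating {ι B : Type*} {S : Set (ι → A)} {W : Set B}
    (h : ∀ I : Finset ι, ∃ f : (ι → A) → B, Set.MapsTo f S W ∧
      ∀ x ∈ S, ∀ y ∈ S, f x = f y → ∀ i ∈ I, x i = y i) : S.encard ≤ W.encard := by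
  have finset_le (F : Finset (ι → A)) (hF : ↑F ⊆ S) : (F : Set (ι → A)).encard ≤ W.encard := by
    -- finitely many points are already told apart by finitely many coordinates
    have separated : ∀ᶠ I : Finset ι in atTop, ∀ x ∈ F, ∀ y ∈ F, (∀ i ∈ I, x i = y i) → x = y := by
      refine (eventually_all_finset F).2 fun x _ => (eventually_all_finset F).2 fun y _ => ?_
      rcases eq_or_ne x y with hxy | hxy
      · exact Eventually.of_forall fun _ _ => hxy
      · obtain ⟨i, hi⟩ := Function.ne_iff.1 hxy
        filter_upwards [eventually_ge_atTop {i}] with I hI h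
        exact absurd (h i (Finset.singleton_subset_iff.1 hI)) hi
    obtain ⟨I, hI⟩ := separated.exists
    obtain ⟨f, hfW, hf⟩ := h I
    exact Set.encard_le_encard_of_injOn (hfW.mono_left hF) fun x hx y hy hxy =>
      hI x hx y hy (hf x (hF hx) y (hF hy) hxy)
  refine ENat.forall_natCast_le_iff_le.1 fun n hn => ?_
  obtain ⟨F, hFS, hF⟩ := Set.exists_subset_encard_eq hn
  lift F to Finset (ι → A) using Set.finite_of_encard_eq_coe hF
  exact hF ▸ finset_le F hFS

variable {p : ℕ} {τ : A → Fin p → A}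

theorem subword_mem_wordsOfLength {x : ℤ → A} (hx : x ∈ subshift τ) (i : ℤ) (n : ℕ) :
    subword x i n ∈ wordsOfLength τ n :=
  ⟨x, hx, i, rfl⟩

theorem finite_wordsOfLength [Finite A] (τ : A → Fin p → A) (n : ℕ) :
    (wordsOfLength τ n).Finite := by
  refine (List.finite_length_eq A n).subset ?_
  rintro _ ⟨x, -, i, rfl⟩
  exact length_subword x i n

theorem image_take_wordsOfLength (τ : A → Fin p → A) (n : ℕ) :
    List.take n '' wordsOfLength τ (n + 1) = wordsOfLength τ n := by
  refine Set.Subset.antisymm ?_ ?_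
  · rintro _ ⟨_, ⟨x, hx, i, rfl⟩, rfl⟩
    exact ⟨x, hx, i, take_subword x i n.le_succ⟩
  · rintro _ ⟨x, hx, i, rfl⟩
    exact ⟨_, subword_mem_wordsOfLength hx i _, take_subword x i n.le_succ⟩

theorem eqOn_Ico_of_injOn_take {n : ℕ} (hinj : Set.InjOn (List.take n) (wordsOfLength τ (n + 1)))
    {x y : ℤ → A} (hx : x ∈ subshift τ) (hy : y ∈ subshift τ) {i : ℤ}
    (h : Set.EqOn x y (Set.Ico i (i + n))) (m : ℕ) : Set.EqOn x y (Set.Ico i (i + n + m)) := by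
  induction m with
  | zero => simpa using h
  | succ m ih =>
    have hword : subword x (i + m) (n + 1) = subword y (i + m) (n + 1) := by
      refine hinj (subword_mem_wordsOfLength hx _ _) (subword_mem_wordsOfLength hy _ _) ?_
      rw [take_subword _ _ n.le_succ, take_subword _ _ n.le_succ, subword_eq_iff_eqOn]
      exact ih.mono (Set.Ico_subset_Ico (by omega) (by omega))
    intro t ht
    rcases lt_or_ge t (i + n + m) with hlt | hge
    · exact ih ⟨ht.1, hlt⟩
    · exact subword_eq_iff_eqOn.1 hword ⟨by omega, by have := ht.2; push_cast at this ⊢; omega⟩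

variable [Finite A]

theorem ncard_wordsOfLength_lt_succ (hinf : (subshift τ).Infinite) (n : ℕ) :
    (wordsOfLength τ n).ncard < (wordsOfLength τ (n + 1)).ncard := by
  by_contra! hle
  have hinj : Set.InjOn (List.take n) (wordsOfLength τ (n + 1)) := by
    refine Set.injOn_of_ncard_image_eq ?_ (finite_wordsOfLength τ _)
    refine le_antisymm (Set.ncard_image_le (finite_wordsOfLength τ _)) ?_
    rwa [image_take_wordsOfLength]
  refine hinf (Set.encard_lt_top_iff.1 (lt_of_le_of_lt
    (encard_le_of_separating (W := wordsOfLength τ n) fun I => ?_)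
      (finite_wordsOfLength τ n).encard_lt_top))
  refine ⟨fun x => subword x (-(I.sup Int.natAbs : ℕ)) n,
    fun x hx => subword_mem_wordsOfLength hx _ _, fun x hx y hy h i hi => ?_⟩
  have hiL : i.natAbs ≤ I.sup Int.natAbs := Finset.le_sup (f := Int.natAbs) hi
  exact eqOn_Ico_of_injOn_take hinj hx hy (subword_eq_iff_eqOn.1 h) (2 * I.sup Int.natAbs + 1)
    ⟨by omega, by omega⟩

theorem lt_ncard_wordsOfLength (hinf : (subshift τ).Infinite) (n : ℕ) :
    n < (wordsOfLength τ n).ncard := by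
  induction n with
  | zero =>
    obtain ⟨x, hx⟩ := hinf.nonempty
    exact (Set.ncard_pos (finite_wordsOfLength τ 0)).2 ⟨_, subword_mem_wordsOfLength hx 0 0⟩
  | succ n ih => exact Nat.lt_of_le_of_lt ih (ncard_wordsOfLength_lt_succ hinf n)

end Complexity

section Recognizability

variable {A : Type*} {p : ℕ} [NeZero p]

/-- The number of distinct levels of the `k`-th tower: the least `c > 0` with
`T ^ c (τ ^ k (X_τ)) = τ ^ k (X_τ)`. -/
noncomputable def towerPeriod (τ : A → Fin p → A) (k : ℕ) : ℕ :=
  Function.minimalPeriod (Set.image (shiftBy 1)) (towerLevel τ k 0)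

theorem towerLevel_add_right_cancel {τ : A → Fin p → A} {k : ℕ} {i j m : ℤ} :
    towerLevel τ k (i + m) = towerLevel τ k (j + m) ↔ towerLevel τ k i = towerLevel τ k j := by
  simp only [← image_shiftBy_towerLevel τ k _ m, (shiftBy_injective m).image_injective.eq_iff]

theorem towerLevel_eq_iff {τ : A → Fin p → A} {k : ℕ} {i j : ℤ} :
    towerLevel τ k i = towerLevel τ k j ↔ i ≡ j [ZMOD towerPeriod τ k] := by
  have zero_eq_iff (n : ℕ) : towerLevel τ k 0 = towerLevel τ k n ↔ towerPeriod τ k ∣ n := by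
    have hiter : (Set.image (shiftBy 1))^[n] (towerLevel τ k 0) = towerLevel τ k n := by
      induction n with
      | zero => simp
      | succ n ih =>
        rw [Function.iterate_succ_apply', ih, image_shiftBy_towerLevel, Nat.cast_succ]
    rw [towerPeriod, ← Function.isPeriodicPt_iff_minimalPeriod_dvd, Function.IsPeriodicPt,
      Function.IsFixedPt, hiter, eq_comm]
  rw [← towerLevel_add_right_cancel (m := -i), add_neg_cancel, ← sub_eq_add_neg, Int.modEq_iff_dvd]
  obtain ⟨n, hn | hn⟩ := Int.eq_nat_or_neg (j - i)
  · rw [hn, zero_eq_iff, Int.natCast_dvd_natCast]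
  · rw [hn, ← towerLevel_add_right_cancel (m := n), neg_add_cancel, zero_add, eq_comm, zero_eq_iff,
      dvd_neg, Int.natCast_dvd_natCast]

theorem towerPeriod_dvd_pow (τ : A → Fin p → A) (k : ℕ) : towerPeriod τ k ∣ p ^ k := by
  have h : towerLevel τ k (p ^ k) = towerLevel τ k 0 := towerLevel_congr τ (by simp [Int.ModEq])
  exact_mod_cast Int.modEq_zero_iff_dvd.1 (towerLevel_eq_iff.1 h)

theorem towerPeriod_pos (τ : A → Fin p → A) (k : ℕ) : 0 < towerPeriod τ k :=
  Nat.pos_of_dvd_of_pos (towerPeriod_dvd_pow τ k) (NeZero.pos _)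

theorem towerPeriod_add_dvd (τ : A → Fin p → A) (j k : ℕ) :
    towerPeriod τ (j + k) ∣ p ^ j * towerPeriod τ k := by
  have h : towerLevel τ k (towerPeriod τ k) = towerLevel τ k 0 :=
    towerLevel_eq_iff.2 (by simp [Int.ModEq])
  have h' := congrArg (Set.image (onSeq τ)^[j]) h
  rw [image_iterate_onSeq_towerLevel, image_iterate_onSeq_towerLevel, mul_zero, towerLevel_eq_iff,
    Int.modEq_zero_iff_dvd] at h'
  exact_mod_cast h'

variable [Finite A] {τ : A → Fin p → A}

theorem ncard_wordsOfLength_le (hp : 2 ≤ p) (hprim : IsPrimitive τ) {k n : ℕ}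
    (hn : n + towerPeriod τ k ≤ p ^ k + 1) :
    (wordsOfLength τ n).ncard ≤ Nat.card A * towerPeriod τ k := by
  have hpos := towerPeriod_pos τ k
  -- each word of length `n` begins at one of the first `c` coordinates of some word `τ ^ k (a)`
  let word (q : A × Fin (towerPeriod τ k)) : List A := ((iterWord τ k q.1).drop q.2).take n
  have hsub : wordsOfLength τ n ⊆ Set.range word := by
    rintro _ ⟨x, hx, i, rfl⟩
    obtain ⟨j, hj⟩ := exists_mem_towerLevel hp hprim (shiftBy_mem τ i hx) k
    have hr0 : 0 ≤ j % towerPeriod τ k := Int.emod_nonneg _ (by omega)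
    have hr1 : j % towerPeriod τ k < towerPeriod τ k := Int.emod_lt_of_pos _ (by omega)
    rw [← towerLevel_eq_iff.2 (Int.mod_modEq j (towerPeriod τ k))] at hj
    lift j % (towerPeriod τ k : ℤ) to ℕ using hr0 with r
    obtain ⟨y, -, hyx⟩ := hj
    refine ⟨(y 0, ⟨r, by omega⟩), ?_⟩
    have hblock : subword ((onSeq τ)^[k] y) 0 (p ^ k) = iterWord τ k (y 0) := by
      simpa using subword_iterate_onSeq_block τ k y 0
    have hx : subword x i n = subword ((onSeq τ)^[k] y) (0 + r) n := by
      rw [← zero_add i, ← subword_shiftBy, ← hyx, subword_shiftBy]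
    rw [hx, subword_eq_take_drop _ _ (by omega : r + n ≤ p ^ k), hblock]
  calc (wordsOfLength τ n).ncard ≤ (Set.range word).ncard :=
        Set.ncard_le_ncard hsub (Set.finite_range word)
    _ ≤ Nat.card (A × Fin (towerPeriod τ k)) := by
        rw [← Set.image_univ, ← Set.ncard_univ]; exact Set.ncard_image_le
    _ = Nat.card A * towerPeriod τ k := by rw [Nat.card_prod, Nat.card_fin]

theorem pow_lt_mul_towerPeriod (hp : 2 ≤ p) (hprim : IsPrimitive τ)
    (hinf : (subshift τ).Infinite) (k : ℕ) : p ^ k < (Nat.card A + 1) * towerPeriod τ k := by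
  have hle := Nat.le_of_dvd (NeZero.pos _) (towerPeriod_dvd_pow τ k)
  have hn : p ^ k + 1 - towerPeriod τ k + towerPeriod τ k ≤ p ^ k + 1 := by omega
  have h := (lt_ncard_wordsOfLength hinf _).trans_le (ncard_wordsOfLength_le hp hprim hn)
  rw [add_one_mul]
  omega

theorem exists_pow_dvd_towerPeriod (hp : 2 ≤ p) (hprim : IsPrimitive τ)
    (hinf : (subshift τ).Infinite) : ∃ m, ∀ k, p ^ k ∣ towerPeriod τ (k + m) := by
  choose d hd using towerPeriod_dvd_pow τ
  obtain ⟨m, hm⟩ : ∃ m, ∀ k, d k ≤ d m := by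
    have hbdd : BddAbove (Set.range d) := by
      refine ⟨Nat.card A + 1, ?_⟩
      rintro _ ⟨k, rfl⟩
      have h := pow_lt_mul_towerPeriod hp hprim hinf k
      rw [hd k, mul_comm] at h
      exact (Nat.lt_of_mul_lt_mul_right h).le
    obtain ⟨m, hm⟩ := Nat.sSup_mem (Set.range_nonempty d) hbdd
    exact ⟨m, fun k => hm ▸ le_csSup hbdd ⟨k, rfl⟩⟩
  refine ⟨m, fun k => ?_⟩
  have hdm : 0 < d m := Nat.pos_of_ne_zero fun h => NeZero.ne (p ^ m) (by rw [hd m, h, mul_zero])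
  have hle : p ^ k * towerPeriod τ m * d m ≤ towerPeriod τ (k + m) * d m := by
    calc p ^ k * towerPeriod τ m * d m = towerPeriod τ (k + m) * d (k + m) := by
          rw [mul_assoc, ← hd m, ← hd (k + m), pow_add]
      _ ≤ towerPeriod τ (k + m) * d m := Nat.mul_le_mul_left _ (hm _)
  have hge := Nat.le_of_dvd (Nat.mul_pos (NeZero.pos _) (towerPeriod_pos τ m))
    (towerPeriod_add_dvd τ k m)
  exact Dvd.intro _ ((Nat.le_of_mul_le_mul_right hle hdm).antisymm hge)

theorem modEq_of_mem_towerLevel (hp : 2 ≤ p) (hprim : IsPrimitive τ)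
    (hinf : (subshift τ).Infinite) {k : ℕ} {i j : ℤ} {x : ℤ → A} (hi : x ∈ towerLevel τ k i)
    (hj : x ∈ towerLevel τ k j) : i ≡ j [ZMOD p ^ k] := by
  obtain ⟨m, hm⟩ := exists_pow_dvd_towerPeriod hp hprim hinf
  have refine_level {i : ℤ} (hi : x ∈ towerLevel τ k i) :
      ∃ a : ℤ, x ∈ towerLevel τ (k + m) (p ^ k * a + i) := by
    obtain ⟨y, hy, rfl⟩ := hi
    obtain ⟨a, ha⟩ := exists_mem_towerLevel hp hprim hy m
    refine ⟨a, shiftBy_mem_towerLevel ?_ i⟩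
    exact image_iterate_onSeq_towerLevel τ k m a ▸ Set.mem_image_of_mem _ ha
  obtain ⟨a, ha⟩ := refine_level hi
  obtain ⟨b, hb⟩ := refine_level hj
  have hmod := towerLevel_eq_iff.1 (towerLevel_eq_of_mem hp hprim ha hb)
  have hpow : p ^ k * a + i ≡ p ^ k * b + j [ZMOD p ^ k] :=
    hmod.of_dvd (by exact_mod_cast hm k)
  simpa [Int.ModEq] using hpow

end Recognizability

section Desubstitution

variable {A : Type*} [Finite A] {p : ℕ}

theorem exists_iterWord_ker_stable (τ : A → Fin p → A) :
    ∃ k, ∀ a b, iterWord τ (k + 1) a = iterWord τ (k + 1) b → iterWord τ k a = iterWord τ k b := by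
  let ker : ℕ →o Set (A × A) :=
    ⟨fun k => {q | iterWord τ k q.1 = iterWord τ k q.2}, monotone_nat_of_le_succ fun k q hq => by
      simp only [Set.mem_ofPred_eq, add_comm k 1, iterWord_add] at hq ⊢
      rw [hq]⟩
  obtain ⟨k, hk⟩ := WellFoundedGT.monotone_chain_condition ker
  exact ⟨k, fun a b hab => (hk (k + 1) k.le_succ).ge (show (a, b) ∈ ker (k + 1) from hab)⟩

variable [NeZero p] {τ : A → Fin p → A}

theorem injOn_onSeq (hp : 2 ≤ p) (hprim : IsPrimitive τ) (hinf : (subshift τ).Infinite) :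
    Set.InjOn (onSeq τ) (subshift τ) := by
  obtain ⟨k, hker⟩ := exists_iterWord_ker_stable τ
  intro x hx y hy hxy
  obtain ⟨i, hi⟩ := exists_mem_towerLevel hp hprim hx k
  obtain ⟨j, hj⟩ := exists_mem_towerLevel hp hprim hy k
  have onSeq_mem {x : ℤ → A} {i : ℤ} (hx : x ∈ towerLevel τ k i) :
      onSeq τ x ∈ towerLevel τ (1 + k) (p ^ 1 * i) :=
    image_iterate_onSeq_towerLevel τ 1 k i ▸ Set.mem_image_of_mem _ hx
  have hmod := modEq_of_mem_towerLevel hp hprim hinf (onSeq_mem hi) (hxy ▸ onSeq_mem hj)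
  rw [pow_add] at hmod
  have hij : i ≡ j [ZMOD p ^ k] := hmod.mul_left_cancel' (by simp [NeZero.ne p])
  rw [towerLevel_congr τ hij] at hi
  obtain ⟨u, -, rfl⟩ := hi
  obtain ⟨v, -, rfl⟩ := hj
  have hsucc : (onSeq τ)^[k + 1] u = (onSeq τ)^[k + 1] v := by
    simp only [onSeq_shiftBy, ← Function.iterate_succ_apply' (onSeq τ) k] at hxy
    exact shiftBy_injective _ hxy
  have hk : (onSeq τ)^[k] u = (onSeq τ)^[k] v :=
    iterate_onSeq_eq_iff.2 fun m => hker _ _ (iterate_onSeq_eq_iff.1 hsucc m)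
  simp only [hk]

theorem existsUnique_onSeq_eq_shiftBy (hp : 2 ≤ p) (hprim : IsPrimitive τ)
    (hinf : (subshift τ).Infinite) (x : subshift τ) :
    ∃! q : subshift τ × Fin p, onSeq τ q.1.1 = shiftBy (-((q.2 : ℕ) : ℤ)) x.1 := by
  have mem_level {y : subshift τ} {r : Fin p} (h : onSeq τ y.1 = shiftBy (-((r : ℕ) : ℤ)) x.1) :
      x.1 ∈ towerLevel τ 1 (r : ℕ) :=
    ⟨y, y.2, by simp [h, shiftBy_shiftBy, shiftBy_zero]⟩
  obtain ⟨i, hi⟩ := exists_mem_towerLevel hp hprim x.2 1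
  have hpos : (0 : ℤ) < p := by omega
  rw [← towerLevel_congr τ (Int.mod_modEq i (p ^ 1)), pow_one] at hi
  lift i % (p : ℤ) to ℕ using Int.emod_nonneg i hpos.ne' with r hr
  have hrp : r < p := by have := Int.emod_lt_of_pos i hpos; omega
  obtain ⟨y, hy, hyx⟩ := hi
  have hy_eq : onSeq τ y = shiftBy (-r) x.1 := by
    simp [← hyx, shiftBy_shiftBy, shiftBy_zero]
  refine ⟨(⟨y, hy⟩, ⟨r, hrp⟩), hy_eq, fun ⟨z, s⟩ hz => ?_⟩
  have hmod := modEq_of_mem_towerLevel hp hprim hinf (mem_level hz)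
    (mem_level (y := ⟨y, hy⟩) (r := ⟨r, hrp⟩) hy_eq)
  obtain rfl : s = ⟨r, hrp⟩ := Fin.ext (Nat.ModEq.eq_of_lt_of_lt
    (by simpa [Int.natCast_modEq_iff] using hmod) s.2 hrp)
  exact Prod.ext (Subtype.ext (injOn_onSeq hp hprim hinf z.2 hy (hz.trans hy_eq.symm))) rfl

theorem existsUnique_desubstitutes (hp : 2 ≤ p) (hprim : IsPrimitive τ)
    (hinf : (subshift τ).Infinite) (x : subshift τ) :
    ∃! q : (ℕ → subshift τ) × (ℕ → Fin p), Desubstitutes τ x q.1 q.2 := by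
  choose f hf huniq using existsUnique_onSeq_eq_shiftBy hp hprim hinf
  let y (n : ℕ) : subshift τ := (fun z => (f z).1)^[n] x
  have y_succ (n : ℕ) : y (n + 1) = (f (y n)).1 := Function.iterate_succ_apply' _ n x
  refine ⟨(y, fun n => (f (y n)).2), ⟨rfl, fun n => ?_⟩, fun ⟨z, δ⟩ ⟨hz0, hz⟩ => ?_⟩
  · simpa only [y_succ] using hf (y n)
  · have step (n : ℕ) : (z (n + 1), δ n) = f (z n) := huniq _ _ (hz n)
    have hzy (n : ℕ) : z n = y n := by
      induction n with
      | zero => exact hz0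
      | succ n ih => rw [y_succ, ← ih, ← step n]
    exact Prod.ext (funext hzy) (funext fun n => by simp only [← hzy, ← step n])

end Desubstitution

section FactorMap

variable {A : Type*} {p : ℕ} [NeZero p] {τ : A → Fin p → A}

theorem Desubstitutes.mem_towerLevel {x : subshift τ} {y : ℕ → subshift τ} {δ : ℕ → Fin p}
    (h : Desubstitutes τ x y δ) (k : ℕ) :
    x.1 ∈ towerLevel τ k (∑ i ∈ Finset.range k, ((δ i : ℕ) : ℤ) * p ^ i) := by
  refine ⟨y k, (y k).2, ?_⟩
  induction k with
  | zero => simp [shiftBy_zero, h.1]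
  | succ k ih =>
    rw [← ih]
    simp only [Function.iterate_succ_apply, h.2 k, iterate_onSeq_shiftBy, shiftBy_shiftBy,
      Finset.sum_range_succ]
    congr 1
    ring

theorem val_odometer_succ_mod (z : odometer p) (k : ℕ) :
    (z.1 (k + 1)).val % p ^ k = (z.1 k).val := by
  rw [← z.2 k, ZMod.castHom_apply, ZMod.cast_eq_val, ZMod.val_natCast]

theorem towerLevel_odometer_antitone (τ : A → Fin p → A) (z : odometer p) (k : ℕ) :
    towerLevel τ (k + 1) (z.1 (k + 1)).val ⊆ towerLevel τ k (z.1 k).val := by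
  refine (towerLevel_subset_add τ k 1 _).trans_eq (towerLevel_congr τ ?_)
  rw [← val_odometer_succ_mod z k]
  exact_mod_cast (Nat.mod_modEq _ _).symm

variable [Finite A]

theorem toOdometer_apply_eq_iff (hp : 2 ≤ p) (hprim : IsPrimitive τ)
    (hinf : (subshift τ).Infinite) {x : subshift τ} {k : ℕ} {n : ℤ} :
    (toOdometer τ x).1 k = (n : ZMod (p ^ k)) ↔ x.1 ∈ towerLevel τ k n := by
  have hex := (existsUnique_desubstitutes hp hprim hinf x).exists
  have hmem := hex.choose_spec.mem_towerLevel k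
  rw [toOdometer, dif_pos hex]
  have hcast : (ofDigits hex.choose.2).1 k =
      ((∑ i ∈ Finset.range k, ((hex.choose.2 i : ℕ) : ℤ) * p ^ i : ℤ) : ZMod (p ^ k)) := by
    simp [ofDigits]
  rw [hcast, ZMod.intCast_eq_intCast_iff]
  push_cast
  exact ⟨fun h => towerLevel_congr τ h ▸ hmem, modEq_of_mem_towerLevel hp hprim hinf hmem⟩

theorem toOdometer_eq_iff (hp : 2 ≤ p) (hprim : IsPrimitive τ) (hinf : (subshift τ).Infinite)
    {x : subshift τ} {z : odometer p} :
    toOdometer τ x = z ↔ ∀ k, x.1 ∈ towerLevel τ k (z.1 k).val := by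
  rw [Subtype.ext_iff, funext_iff]
  refine forall_congr' fun k => ?_
  rw [← toOdometer_apply_eq_iff hp hprim hinf, Int.cast_natCast, ZMod.natCast_zmod_val]

theorem toOdometer_shift (hp : 2 ≤ p) (hprim : IsPrimitive τ) (hinf : (subshift τ).Infinite)
    (x : subshift τ) : toOdometer τ (shift τ x) = addOne p (toOdometer τ x) := by
  refine Subtype.ext (funext fun k => ?_)
  have hx := shiftBy_mem_towerLevel ((toOdometer_eq_iff hp hprim hinf (x := x)).1 rfl k) 1
  have hshift := (toOdometer_apply_eq_iff hp hprim hinf (x := shift τ x)).2 hx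
  rwa [Int.cast_add, Int.cast_natCast, ZMod.natCast_zmod_val, Int.cast_one] at hshift

variable [TopologicalSpace A] [DiscreteTopology A]

theorem continuous_toOdometer (hp : 2 ≤ p) (hprim : IsPrimitive τ)
    (hinf : (subshift τ).Infinite) : Continuous (toOdometer τ) := by
  refine continuous_induced_rng.2 (continuous_pi fun k => ?_)
  have isClosed_fiber (v : ZMod (p ^ k)) :
      IsClosed ((fun x : subshift τ => (toOdometer τ x).1 k) ⁻¹' {v}) := by
    have h : (fun x : subshift τ => (toOdometer τ x).1 k) ⁻¹' {v} =
        Subtype.val ⁻¹' towerLevel τ k v.val := by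
      ext x
      simp [← toOdometer_apply_eq_iff hp hprim hinf]
    exact h ▸ (isCompact_towerLevel τ k _).isClosed.preimage continuous_subtype_val
  refine continuous_iff_isClosed.2 fun s _ => ?_
  have h := s.toFinite.isClosed_biUnion fun v _ => isClosed_fiber v
  rwa [← Set.preimage_iUnion₂, Set.biUnion_of_singleton] at h

theorem surjective_toOdometer (hp : 2 ≤ p) (hprim : IsPrimitive τ)
    (hinf : (subshift τ).Infinite) : Function.Surjective (toOdometer τ) := by
  intro z
  obtain ⟨x, hx⟩ := IsCompact.nonempty_iInter_of_sequence_nonempty_isCompact_isClosed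
    (fun k => towerLevel τ k (z.1 k).val) (towerLevel_odometer_antitone τ z)
    (fun k => hinf.nonempty.image _) (isCompact_towerLevel τ 0 _)
    (fun k => (isCompact_towerLevel τ k _).isClosed)
  rw [Set.mem_iInter] at hx
  exact ⟨⟨x, towerLevel_subset τ _ _ (hx 0)⟩, (toOdometer_eq_iff hp hprim hinf).2 hx⟩

theorem isFactorMap_toOdometer (hp : 2 ≤ p) (hprim : IsPrimitive τ)
    (hinf : (subshift τ).Infinite) : IsFactorMap (shift τ) (addOne p) (toOdometer τ) :=
  ⟨continuous_toOdometer hp hprim hinf, surjective_toOdometer hp hprim hinf,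
    toOdometer_shift hp hprim hinf⟩

end FactorMap

section Fibers

variable {A : Type*} {p : ℕ} [NeZero p]

theorem monotone_val_odometer (z : odometer p) : Monotone fun k => (z.1 k).val :=
  monotone_nat_of_le_succ fun k => val_odometer_succ_mod z k ▸ Nat.mod_le _ _

theorem exists_two_blocks_cover (hp : 2 ≤ p) (z : odometer p) :
    ∃ e : ℤ, ∀ L : ℕ, ∃ k, ∀ i : ℤ, i.natAbs ≤ L →
      (i + (z.1 k).val) / (p : ℤ) ^ k ∈ Set.Ico e (e + 2) := by
  have hpos (k : ℕ) : (0 : ℤ) < p ^ k := by exact_mod_cast NeZero.pos (p ^ k)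
  have hval (k : ℕ) : ((z.1 k).val : ℤ) < p ^ k := by exact_mod_cast ZMod.val_lt (z.1 k)
  have hpow (k : ℕ) : (k : ℤ) < p ^ k := by exact_mod_cast Nat.lt_pow_self (by omega : 1 < p)
  simp only [Set.mem_Ico, Int.le_ediv_iff_mul_le (hpos _), Int.ediv_lt_iff_lt_mul (hpos _)]
  by_cases hbdd : ∃ B, ∀ k, (z.1 k).val ≤ B
  · obtain ⟨B, hB⟩ := hbdd
    refine ⟨-1, fun L => ⟨L + B, fun i hi => ?_⟩⟩
    have := hpow (L + B)
    have := hB (L + B)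
    omega
  · push Not at hbdd
    refine ⟨0, fun L => ?_⟩
    obtain ⟨k, hk⟩ := hbdd L
    have : (z.1 k).val ≤ (z.1 (L + k)).val := monotone_val_odometer z (Nat.le_add_left k L)
    have := hpow (L + k)
    have := hval (L + k)
    exact ⟨L + k, fun i hi => by omega⟩

variable [Finite A] {τ : A → Fin p → A}

theorem encard_fiber_toOdometer_le (hp : 2 ≤ p) (hprim : IsPrimitive τ)
    (hinf : (subshift τ).Infinite) (z : odometer p) :
    (toOdometer τ ⁻¹' {z}).encard ≤ (wordsOfLength τ 2).encard := by
  obtain ⟨e, he⟩ := exists_two_blocks_cover hp z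
  rw [← Subtype.val_injective.encard_image]
  refine encard_le_of_separating fun I => ?_
  obtain ⟨k, hk⟩ := he (I.sup Int.natAbs)
  have hlevel : ∀ x ∈ Subtype.val '' (toOdometer τ ⁻¹' {z}), x ∈ towerLevel τ k (z.1 k).val := by
    rintro _ ⟨x, hx, rfl⟩
    exact (toOdometer_eq_iff hp hprim hinf).1 hx k
  choose! y hy hyx using hlevel
  refine ⟨fun x => subword (y x) e 2, fun x hx => subword_mem_wordsOfLength (hy x hx) e 2,
    fun x hx x' hx' hword i hi => ?_⟩
  rw [← hyx x hx, ← hyx x' hx']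
  refine iterate_onSeq_apply_congr (congrArg _ (subword_eq_iff_eqOn.1 hword ?_))
  exact hk i (Finset.le_sup (f := Int.natAbs) hi)

theorem finite_fiber_toOdometer (hp : 2 ≤ p) (hprim : IsPrimitive τ)
    (hinf : (subshift τ).Infinite) (z : odometer p) : (toOdometer τ ⁻¹' {z}).Finite :=
  Set.encard_lt_top_iff.1 <|
    (encard_fiber_toOdometer_le hp hprim hinf z).trans_lt (finite_wordsOfLength τ 2).encard_lt_top

theorem ncard_fiber_toOdometer_lt (hp : 2 ≤ p) (hprim : IsPrimitive τ)
    (hinf : (subshift τ).Infinite) (z : odometer p) :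
    (toOdometer τ ⁻¹' {z}).ncard < (wordsOfLength τ 3).ncard :=
  (ENat.toNat_le_toNat (encard_fiber_toOdometer_le hp hprim hinf z)
    (finite_wordsOfLength τ 2).encard_lt_top.ne).trans_lt (ncard_wordsOfLength_lt_succ hinf 2)

end Fibers

section LiYorke

variable {X : Type*} [MetricSpace X] [CompactSpace X] {T : X → X} {x y : X}

theorem IsLiYorkePair.frequently_dist_lt (h : IsLiYorkePair T x y) {ε : ℝ} (hε : 0 < ε) :
    ∃ᶠ n in atTop, dist (T^[n] x) (T^[n] y) < ε := by
  refine frequently_lt_of_liminf_lt ?_ (h.2.trans_lt hε)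
  exact (isBoundedUnder_of ⟨Metric.diam (Set.univ : Set X), fun n =>
    Metric.dist_le_diam_of_mem isCompact_univ.isBounded trivial trivial⟩).isCoboundedUnder_ge

theorem IsLiYorkePair.eq_of_semiconj {D : Type*} {f : X → D} {s : D → D}
    (h : IsLiYorkePair T x y) (hf : IsLocallyConstant f) (hs : Function.Injective s)
    (hfs : Function.Semiconj f T s) : f x = f y := by
  obtain ⟨ε, hε, hball⟩ := lebesgue_number_lemma_of_metric (c := fun d => f ⁻¹' {d}) isCompact_univ
    (fun d => hf.isOpen_fiber d) fun x _ => Set.mem_iUnion.2 ⟨f x, rfl⟩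
  obtain ⟨n, hn⟩ := (h.frequently_dist_lt hε).exists
  obtain ⟨d, hd⟩ := hball (T^[n] y) trivial
  have heq : f (T^[n] x) = f (T^[n] y) :=
    (hd (Metric.mem_ball.2 hn)).trans (hd (Metric.mem_ball_self hε)).symm
  rw [(hfs.iterate_right n).eq, (hfs.iterate_right n).eq] at heq
  exact hs.iterate n heq

theorem IsLiYorkePair.eq_of_semiconj_addOne {p : ℕ} {π : X → odometer p}
    (h : IsLiYorkePair T x y) (hπ : Continuous π) (hT : Function.Semiconj π T (addOne p)) :
    π x = π y := by
  refine Subtype.ext (funext fun k => ?_)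
  refine h.eq_of_semiconj (f := fun x => (π x).1 k) (s := (· + 1)) ?_ (add_left_injective 1) ?_
  · exact (IsLocallyConstant.iff_continuous _).2
      ((continuous_apply k).comp (continuous_subtype_val.comp hπ))
  · exact fun x => congrArg (fun z => z.1 k) (hT x)

theorem IsScrambled.finite_of_semiconj_addOne {p : ℕ} {π : X → odometer p} {S : Set X}
    (hS : IsScrambled T S) (hπ : Continuous π) (hT : Function.Semiconj π T (addOne p))
    (hfib : ∀ z, (π ⁻¹' {z}).Finite) : S.Finite := by
  have himage : (π '' S).Subsingleton := by
    rintro _ ⟨x, hx, rfl⟩ _ ⟨y, hy, rfl⟩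
    by_contra hne
    exact hne ((hS x hx y hy (ne_of_apply_ne π hne)).eq_of_semiconj_addOne hπ hT)
  exact (himage.finite.preimage' fun z _ => hfib z).subset (Set.subset_preimage_image π S)

end LiYorke

theorem finite_of_isScrambled_shift {A : Type*} [Finite A] [TopologicalSpace A]
    [DiscreteTopology A] {p : ℕ} [NeZero p] {τ : A → Fin p → A} (hp : 2 ≤ p)
    (hprim : IsPrimitive τ) (hinf : (subshift τ).Infinite) (ϱ : MetricSpace (subshift τ))
    (hϱ : ϱ.toPseudoMetricSpace.toUniformSpace.toTopologicalSpace =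
      (instTopologicalSpaceSubtype : TopologicalSpace (subshift τ)))
    {S : Set (subshift τ)} (hS : @IsScrambled _ ϱ (shift τ) S) : S.Finite := by
  have hcompact : @CompactSpace _ ϱ.toPseudoMetricSpace.toUniformSpace.toTopologicalSpace :=
    hϱ ▸ isCompact_iff_compactSpace.1 (isClosed_subshift τ).isCompact
  have hcont : @Continuous _ _ ϱ.toPseudoMetricSpace.toUniformSpace.toTopologicalSpace _
      (toOdometer τ) :=
    hϱ ▸ continuous_toOdometer hp hprim hinf
  exact @IsScrambled.finite_of_semiconj_addOne _ ϱ hcompact _ _ _ _ hS hcont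
    (toOdometer_shift hp hprim hinf) (finite_fiber_toOdometer hp hprim hinf)

end ConstLength

/-- Two-sided sequences carry the product of the discrete topologies on the alphabet `A`. The last
part holds for every metric that induces the topology of `X_τ`. -/
theorem lemma2p7 {A : Type*} [Finite A] [TopologicalSpace A] [DiscreteTopology A]
    {p : ℕ} [NeZero p] (hp : 2 ≤ p) (τ : A → Fin p → A)
    (hprim : ConstLength.IsPrimitive τ) (hinf : (ConstLength.subshift τ).Infinite) :
    (∀ x : ConstLength.subshift τ,
      ∃! q : (ℕ → ConstLength.subshift τ) × (ℕ → Fin p),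
        ConstLength.Desubstitutes τ x q.1 q.2) ∧
    ConstLength.IsFactorMap (ConstLength.shift τ) (ConstLength.addOne p)
      (ConstLength.toOdometer τ) ∧
    (∀ z : ConstLength.odometer p,
      (ConstLength.toOdometer τ ⁻¹' {z}).Finite ∧
      (ConstLength.toOdometer τ ⁻¹' {z}).ncard < (ConstLength.wordsOfLength τ 3).ncard) ∧
    (∀ ϱ : MetricSpace (ConstLength.subshift τ),
      ϱ.toPseudoMetricSpace.toUniformSpace.toTopologicalSpace =
        (instTopologicalSpaceSubtype : TopologicalSpace (ConstLength.subshift τ)) →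
      ∀ S : Set (ConstLength.subshift τ),
        @ConstLength.IsScrambled _ ϱ (ConstLength.shift τ) S → S.Finite) := by
  exact ⟨fun x => ConstLength.existsUnique_desubstitutes hp hprim hinf x,
    ConstLength.isFactorMap_toOdometer hp hprim hinf,
    fun z => ⟨ConstLength.finite_fiber_toOdometer hp hprim hinf z,
      ConstLength.ncard_fiber_toOdometer_lt hp hprim hinf z⟩,
    fun ϱ hϱ S hS => ConstLength.finite_of_isScrambled_shift hp hprim hinf ϱ hϱ hS⟩
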